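/- Model. The network is a connected simple graph $G$ with $n\ge 1$ nodes. Each node has a distinct ID, a non-negative integer of value at most $n^{c}$ for a constant $c$, and numbers its incident edges arbitrarily by ports $1,\dots,\delta$, where $\delta$ is its degree. An arbitrary set of edges of $G$ is labeled; they form a subgraph $T$. All nodes are given the same integer $\tilde n$ with $\tilde n\in[n/\alpha,\alpha n]$ (an $\alpha$-approximation of $n$). In the $\mathsf{KT}_0$ model a node initially knows only its own ID, $\tilde n$, its degree and which of its ports lead to labeled edges (and $\alpha$); in particular, it does not know the IDs of its neighbors. Computation is synchronous, all nodes start simultaneously, and in each round a node may send one message over each of its ports; in the $\mathsf{CONGEST}$ model each message has $O(\log n)$ bits. Each node eventually terminates with an irrevocable output $0$ or $1$, and sends nothing afterwards. Spanning tree verification requires that all nodes output $1$ if $T$ is a spanning tree of $G$ (a connected acyclic graph that contains all nodes). Otherwise, One-Detects requires that at least one node outputs $0$, and All-Detect requires that every node outputs $0$. Theorem. Let $1\le\alpha<\sqrt2$. There is a deterministic $\mathsf{KT}_0$ $\mathsf{CONGEST}$ algorithm (depending on $\alpha$) that, on all such inputs with an $\alpha$-approximation $\tilde n$ of $n$, solves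 spanning tree verification under One-Detects, sends $O(n\log n)$ messages in total, and, for $n\ge2$, terminates at all nodes within $O(n\log n)$ rounds. Moreover, if the nodes know the network size exactly ($\alpha=1$), the algorithm guarantees All-Detect. The constants in the bounds on messages and rounds are absolute, and the constant in the bound on the message size depends only on $c$. -/

import Mathlib

namespace CongestKT0

/-- A deterministic algorithm for synchronous message passing with `KT_0` initial knowledge.
A message is a finite string of bits. All functions may depend on the number `δ` of ports of the
node that runs them; local computation is unrestricted. -/
structure Algorithm where
  /-- The local states of a node that has `δ` ports. -/
  State : ℕ → Type
  /-- The initial state. It depends only on the node's own ID, on the given approximation of the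
  network size, on the degree, and on which of the ports lead to labeled edges. -/
  init : {δ : ℕ} → (id : ℕ) → (approx : ℕ) → (label : Fin δ → Bool) → State δ
  /-- The message (if any) that is sent over each of the ports in the current round. -/
  send : {δ : ℕ} → State δ → Fin δ → Option (List Bool)
  /-- The state transition, given the message (if any) received over each of the ports. -/
  receive : {δ : ℕ} → State δ → (Fin δ → Option (List Bool)) → State δ
  /-- The output: `none` while the node has not terminated, `some true` for `1` (accept),
  `some false` for `0` (reject). -/
  output : {δ : ℕ} → State δ → Option Bool

/-- An input for spanning tree verification on the node set `V`: a connected communication graph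
with distinct node IDs and an arbitrary port numbering at every node, a labeled subgraph, which is
given by its edges, and an integer that is told to all nodes. -/
structure Input (V : Type) where
  /-- The communication graph. -/
  graph : SimpleGraph V
  connected : graph.Connected
  /-- The node IDs. -/
  id : V → ℕ
  id_injective : Function.Injective id
  /-- The number of ports, which `port` forces to be the degree. -/
  deg : V → ℕ
  /-- The neighbor that each port leads to. -/
  port : (v : V) → Fin (deg v) ≃ graph.neighborSet v
  /-- The labeled edges. -/
  tree : SimpleGraph V
  tree_le : tree ≤ graph
  /-- The approximation of the network size. -/
  approx : ℕ

namespace Input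

variable {V : Type} (I : Input V)

/-- The node at the other end of port `p` of `v`. -/
def neighbor (v : V) (p : Fin (I.deg v)) : V := (I.port v p).1

/-- The port, at the node at the other end of port `p` of `v`, that leads back to `v`. -/
def backPort (v : V) (p : Fin (I.deg v)) : Fin (I.deg (I.neighbor v p)) :=
  (I.port (I.neighbor v p)).symm ⟨v, (I.port v p).2.symm⟩

open Classical in
/-- The labels of the edges incident to `v`, as seen at the ports of `v`. -/
noncomputable def label (v : V) (p : Fin (I.deg v)) : Bool :=
  decide (I.tree.Adj v (I.neighbor v p))

/-- The labeled edges form a spanning tree of the communication graph, that is, a connected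
acyclic graph on all of `V`. -/
def Legal : Prop := I.tree.IsTree

end Input

namespace Algorithm

variable (A : Algorithm) {V : Type} (I : Input V)

/-- What a node in state `s` really sends: a node that has terminated sends nothing. -/
def outbox {δ : ℕ} (s : A.State δ) (p : Fin δ) : Option (List Bool) :=
  if (A.output s).isSome then none else A.send s p

/-- One transition: a node that has terminated keeps its state, and hence its output. -/
def update {δ : ℕ} (s : A.State δ) (inbox : Fin δ → Option (List Bool)) : A.State δ :=
  if (A.output s).isSome then s else A.receive s inbox

/-- The state of every node after `r` rounds. In each round all nodes send their messages
simultaneously, and then all nodes change state according to the messages received. -/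
noncomputable def state : ℕ → (v : V) → A.State (I.deg v)
  | 0 => fun v => A.init (I.id v) I.approx (I.label v)
  | r + 1 => fun v => A.update (state r v)
      (fun p => A.outbox (state r (I.neighbor v p)) (I.backPort v p))

/-- The message (if any) that `v` sends over its port `p` in the round after the first `r`. -/
noncomputable def sent (r : ℕ) (v : V) (p : Fin (I.deg v)) : Option (List Bool) :=
  A.outbox (A.state I r v) p

/-- Node `v` eventually terminates with output `b`. -/
def Outputs (v : V) (b : Bool) : Prop := ∃ r, A.output (A.state I r v) = some b

/-- All nodes have terminated after at most `R` rounds. -/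
def TerminatesWithin (R : ℕ) : Prop := ∀ v, (A.output (A.state I R v)).isSome

/-- The number of messages that all nodes together send in the first `R` rounds. -/
noncomputable def messages [Fintype V] (R : ℕ) : ℕ :=
  ∑ r ∈ Finset.range R, ∑ v : V,
    (Finset.univ.filter (fun p : Fin (I.deg v) => (A.sent I r v p).isSome)).card

/-- Every message that is ever sent has at most `b` bits. -/
def MessageBitsLE (b : ℝ) : Prop :=
  ∀ r v p m, A.sent I r v p = some m → (m.length : ℝ) ≤ b

/-- The requirement on legal inputs: every node outputs `1`. -/
def AcceptsIfLegal : Prop := I.Legal → ∀ v, A.Outputs I v true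

/-- The requirement on illegal inputs under One-Detects: at least one node outputs `0`. -/
def OneDetects : Prop := ¬ I.Legal → ∃ v, A.Outputs I v false

/-- The requirement on illegal inputs under All-Detect: every node outputs `0`. -/
def AllDetect : Prop := ¬ I.Legal → ∀ v, A.Outputs I v false

end Algorithm

/-- `approx` is an `α`-approximation of `n`. -/
def IsApprox (α : ℝ) (n approx : ℕ) : Prop :=
  (n : ℝ) / α ≤ approx ∧ (approx : ℝ) ≤ α * n

end CongestKT0

/-!
# Spanning tree verification by counting branches

The algorithm works on the labeled graph `T` only. As soon as a node has received a number over
all of its labeled ports except possibly `p`, it sends over `p` one plus the sum of the numbers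
received over the other labeled ports. After `2 * approx` rounds, which is at least the network
size `n`, every node stops. It accepts if it has received a number over all of its labeled ports,
and if one plus the sum of these numbers, `k`, satisfies `approx ≤ α * k`.

*Soundness.* Let `side T v u` be the set of nodes that `v` reaches in `T` without the edge `vu`. If
`v` sends `x` to `u`, then `x` is the size of `side T v u`, and all edges that touch this set, in
particular `vu`, are bridges of `T`. This is the predicate `Branch`. It propagates (`Branch.join`)
because `side T v u` consists of `v` and of the pairwise disjoint sides of the other neighbors
of `v`, seen from `v`. The same lemma with `u = v` shows that an accepting node lies in a component
of `T` that has `k` nodes and in which all edges are bridges. Since `approx ≤ α * k`,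
`n ≤ α * approx` and `α ^ 2 < 2`, this component has more than half of all nodes. If all nodes
accept, there is thus only one component, and `T` is a spanning tree. If `α = 1`, then a single
accepting node has a component of size `n`.

*Completeness.* If `T` is a tree, then the sides of the other neighbors of `v` are strictly smaller
than `side T v u`, so that the message from `v` to `u` is delivered within as many rounds as
`side T v u` has nodes.

*Complexity.* At most one message is sent over each edge in each direction, and only over bridges
of `T`. The bridges form a forest, so that there are at most `2 * (n - 1)` messages. Each of them
is the binary representation of a number that is at most `n`. The number of rounds is at most
`2 * α * n`.
-/

namespace CongestKT0

open SimpleGraph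

/-! ### Sides of an edge -/

section Graph

variable {V : Type} {T : SimpleGraph V} {v u : V}

/-- The nodes that are reachable from `v` in `T` without the edge between `v` and `u`. For `u = v`,
nothing is deleted, and this is the connected component of `v`. -/
def side (T : SimpleGraph V) (v u : V) : Set V :=
  {w | (T.deleteEdges {s(v, u)}).Reachable v w}

lemma mem_side_self : v ∈ side T v u := Reachable.refl v

lemma mem_side_of_adj {a b : V} (ha : a ∈ side T v u) (hab : T.Adj a b) (hne : s(a, b) ≠ s(v, u)) :
    b ∈ side T v u :=
  Reachable.trans ha (Adj.reachable (by simpa [deleteEdges_adj, hab] using hne))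

lemma side_induction {P : V → Prop} (h0 : P v)
    (hs : ∀ a b, a ∈ side T v u → P a → T.Adj a b → s(a, b) ≠ s(v, u) → P b)
    {w : V} (hw : w ∈ side T v u) : P w := by
  have hw' := (reachable_iff_reflTransGen _ _).1 hw
  induction hw' with
  | refl => exact h0
  | @tail b c hb hbc ih =>
    have hb' : b ∈ side T v u := (reachable_iff_reflTransGen _ _).2 hb
    rw [deleteEdges_adj] at hbc
    exact hs b c hb' (ih hb') hbc.1 (by simpa using hbc.2)

lemma mem_side_diag {w : V} : w ∈ side T v v ↔ T.Reachable v w := by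
  have : T.deleteEdges {s(v, v)} = T := by
    ext a b
    simp only [deleteEdges_adj, Set.mem_singleton_iff, and_iff_left_iff_imp]
    intro h he
    rw [Sym2.eq_iff] at he
    obtain ⟨rfl, rfl⟩ | ⟨rfl, rfl⟩ := he <;> exact h.ne rfl
  rw [side, this, Set.mem_ofPred_eq]

/-- Seen from `v`, the side of a neighbor `a ≠ u` across a bridge is contained in the side of `v`,
seen from `u`. -/
lemma side_subset_side {a : V} (hav : T.Adj v a) (hau : a ≠ u) (hb : v ∉ side T a v) :
    side T a v ⊆ side T v u := by
  intro w hw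
  refine side_induction (P := fun w => w ∈ side T v u) ?_ ?_ hw
  · refine mem_side_of_adj mem_side_self hav ?_
    rw [Ne, Sym2.eq_iff]
    rintro (⟨-, h⟩ | ⟨h, h'⟩)
    · exact hau h
    · exact hav.ne h'.symm
  · intro c d hc hc' hcd hne
    refine mem_side_of_adj hc' hcd ?_
    -- the walk inside the side of `a` does not visit `v`
    have hd := mem_side_of_adj hc hcd hne
    rw [Ne, Sym2.eq_iff]
    rintro (⟨rfl, -⟩ | ⟨-, rfl⟩)
    · exact hb hc
    · exact hb hd

lemma side_disjoint_side {a b : V} (hav : T.Adj v a) (hbv : T.Adj v b) (hab : a ≠ b)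
    (ha : v ∉ side T a v) (hb : v ∉ side T b v) : Disjoint (side T a v) (side T b v) := by
  rw [Set.disjoint_right]
  intro w hw
  refine side_induction (P := fun w => w ∉ side T a v) ?_ ?_ hw
  · intro h
    refine ha (mem_side_of_adj h hbv.symm ?_)
    rw [Ne, Sym2.eq_iff]
    rintro (⟨h, -⟩ | ⟨h, -⟩)
    · exact hab h.symm
    · exact hbv.ne h.symm
  · intro c d hc hc' hcd hne hd
    refine hc' (mem_side_of_adj hd hcd.symm ?_)
    have hd' := mem_side_of_adj hc hcd hne
    rw [Ne, Sym2.eq_iff]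
    rintro (⟨-, rfl⟩ | ⟨rfl, -⟩)
    · exact hb hc
    · exact hb hd'

lemma side_eq_insert_iUnion {ι : Type*} (s : Finset ι) (nb : ι → V)
    (hadj : ∀ i ∈ s, T.Adj v (nb i)) (hne : ∀ i ∈ s, nb i ≠ u)
    (hall : ∀ w, T.Adj v w → w = u ∨ ∃ i ∈ s, nb i = w)
    (hb : ∀ i ∈ s, v ∉ side T (nb i) v) :
    side T v u = insert v (⋃ i ∈ s, side T (nb i) v) := by
  apply Set.Subset.antisymm
  · intro w hw
    refine side_induction (P := fun w => w ∈ insert v (⋃ i ∈ s, side T (nb i) v)) ?_ ?_ hw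
    · exact Set.mem_insert _ _
    · rintro c d - hc hcd hne'
      rw [Set.mem_insert_iff, Set.mem_iUnion₂] at hc ⊢
      obtain rfl | ⟨i, hi, hc⟩ := hc
      · obtain rfl | ⟨i, hi, rfl⟩ := hall d hcd
        · exact absurd rfl hne'
        · exact Or.inr ⟨i, hi, mem_side_self⟩
      · by_cases he : s(c, d) = s(nb i, v)
        · rw [Sym2.eq_iff] at he
          obtain ⟨-, rfl⟩ | ⟨rfl, -⟩ := he
          · exact Or.inl rfl
          · exact absurd hc (hb i hi)
        · exact Or.inr ⟨i, hi, mem_side_of_adj hc hcd he⟩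
  · rw [Set.insert_subset_iff]
    exact ⟨mem_side_self, Set.iUnion₂_subset fun i hi =>
      side_subset_side (hadj i hi) (hne i hi) (hb i hi)⟩

/-! ### Branches -/

/-- What the number `x` certifies when `v` sends it to its neighbor `u`: the side of `v` has `x`
nodes, and all edges that touch it, including the one to `u`, are bridges. For `u = v`, the set is
the component of `v`. -/
structure Branch (T : SimpleGraph V) (v u : V) (x : ℕ) : Prop where
  ncard_eq : (side T v u).ncard = x
  isBridge : ∀ a ∈ side T v u, ∀ b, T.Adj a b → T.IsBridge s(a, b)

lemma Branch.notMem {x : ℕ} (h : Branch T v u x) (hvu : T.Adj v u) : u ∉ side T v u :=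
  h.isBridge v mem_side_self u hvu

/-- The branches at the other neighbors of `v` combine to the branch of `v`, seen from `u`.
With `u = v`, the branches at all neighbors combine to the component. -/
lemma Branch.join [Finite V] {ι : Type*} (s : Finset ι) (nb : ι → V) (f : ι → ℕ)
    (hinj : Set.InjOn nb s)
    (hadj : ∀ i ∈ s, T.Adj v (nb i)) (hne : ∀ i ∈ s, nb i ≠ u)
    (hall : ∀ w, T.Adj v w → w = u ∨ ∃ i ∈ s, nb i = w)
    (hbr : ∀ i ∈ s, Branch T (nb i) v (f i)) :
    Branch T v u (1 + ∑ i ∈ s, f i) := by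
  have hb : ∀ i ∈ s, v ∉ side T (nb i) v := fun i hi => (hbr i hi).notMem (hadj i hi).symm
  have heq := side_eq_insert_iUnion s nb hadj hne hall hb
  constructor
  · rw [heq, Set.ncard_insert_of_notMem (by simpa using hb), add_comm]
    congr 1
    have hcard := Set.ncard_iUnion_of_finite (s := fun i : s => side T (nb i) v)
      (fun i => Set.toFinite _) (fun i j hij => side_disjoint_side (hadj i i.2) (hadj j j.2)
        (fun h => hij (Subtype.ext (hinj i.2 j.2 h))) (hb i i.2) (hb j j.2))
    rw [Set.iUnion_subtype] at hcard
    rw [hcard, finsum_eq_sum_of_fintype, ← Finset.sum_coe_sort s f]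
    exact Finset.sum_congr rfl fun i _ => (hbr i i.2).ncard_eq
  · intro a ha b hab
    rw [heq, Set.mem_insert_iff, Set.mem_iUnion₂] at ha
    obtain rfl | ⟨i, hi, ha⟩ := ha
    · by_cases hbu : b = u
      · subst hbu
        change b ∉ side T a b
        rw [heq, Set.mem_insert_iff, Set.mem_iUnion₂]
        rintro (h | ⟨i, hi, h⟩)
        · exact hab.ne h.symm
        · refine hb i hi (mem_side_of_adj h hab.symm ?_)
          rw [Ne, Sym2.eq_iff]
          rintro (⟨h, -⟩ | ⟨h, -⟩)
          · exact hne i hi h.symm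
          · exact hab.ne h.symm
      · obtain h | ⟨i, hi, rfl⟩ := hall b hab
        · exact absurd h hbu
        · rw [Sym2.eq_swap]
          exact (hbr i hi).isBridge _ mem_side_self _ hab.symm
    · exact (hbr i hi).isBridge a ha b hab

lemma Branch.le_card [Fintype V] {x : ℕ} (h : Branch T v u x) : x ≤ Fintype.card V := by
  rw [← h.ncard_eq, ← Nat.card_eq_fintype_card]
  exact Set.ncard_le_card _

lemma Branch.isTree_of_forall_mem [Nonempty V] {x : ℕ} (h : Branch T v v x)
    (hall : ∀ w, w ∈ side T v v) : T.IsTree where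
  preconnected a b := (mem_side_diag.1 (hall a)).symm.trans (mem_side_diag.1 (hall b))
  isAcyclic := isAcyclic_iff_forall_adj_isBridge.2 fun a b hab => h.isBridge a (hall a) b hab

lemma Branch.isTree_of_card_le [Fintype V] {x : ℕ} (h : Branch T v v x)
    (hx : Fintype.card V ≤ x) : T.IsTree := by
  have : Nonempty V := ⟨v⟩
  refine h.isTree_of_forall_mem fun w => ?_
  rw [Set.eq_of_subset_of_ncard_le (Set.subset_univ (side T v v))
    (by rw [Set.ncard_univ, Nat.card_eq_fintype_card, h.ncard_eq]; exact hx)]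
  trivial

/-- Two components that have more than half of the nodes each are equal. -/
lemma isTree_of_forall_branch [Fintype V] [Nonempty V]
    (h : ∀ v, ∃ x, Branch T v v x ∧ Fintype.card V < 2 * x) : T.IsTree := by
  let v : V := Classical.arbitrary V
  obtain ⟨x, hx, hx2⟩ := h v
  refine hx.isTree_of_forall_mem fun w => ?_
  obtain ⟨y, hy, hy2⟩ := h w
  by_contra hw
  have hd : Disjoint (side T v v) (side T w w) := by
    rw [Set.disjoint_left]
    intro a ha ha'
    exact hw (mem_side_diag.2 ((mem_side_diag.1 ha).trans (mem_side_diag.1 ha').symm))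
  have hu := Set.ncard_union_eq hd
  have hle := Set.ncard_le_card (side T v v ∪ side T w w)
  rw [hx.ncard_eq, hy.ncard_eq] at hu
  rw [Nat.card_eq_fintype_card] at hle
  omega

/-- The bridges of a graph form a forest. -/
lemma card_filter_adj_isBridge_le [Fintype V] [Nonempty V] (T : SimpleGraph V) :
    ∑ v : V, {w | T.Adj v w ∧ T.IsBridge s(v, w)}.ncard ≤ 2 * (Fintype.card V - 1) := by
  classical
  let F : SimpleGraph V :=
    { Adj := fun v w => T.Adj v w ∧ T.IsBridge s(v, w)
      symm := ⟨fun v w h => ⟨h.1.symm, by rw [Sym2.eq_swap]; exact h.2⟩⟩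
      loopless := ⟨fun v h => h.1.ne rfl⟩ }
  have hF : F.IsAcyclic := isAcyclic_iff_forall_adj_isBridge.2 fun v w h =>
    IsBridge.anti (fun _ _ h => h.1) h.2
  obtain ⟨S, hFS, -, hS⟩ :=
    (connected_top (V := V)).exists_isTree_le_of_le_of_isAcyclic le_top hF
  have hdeg : ∀ v, {w | T.Adj v w ∧ T.IsBridge s(v, w)}.ncard = F.degree v := by
    intro v
    rw [← card_neighborFinset_eq_degree, ← Set.ncard_coe_finset, coe_neighborFinset]
    rfl
  rw [Finset.sum_congr rfl fun v _ => hdeg v, F.sum_degrees_eq_twice_card_edges]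
  have h1 := hS.card_edgeFinset
  have h2 := Finset.card_le_card (edgeFinset_mono hFS)
  omega

end Graph

/-! ### The algorithm -/

/-- The number with the given binary digits, least significant digit first. -/
def decodeBits : List Bool → ℕ
  | [] => 0
  | b :: l => Nat.bit b (decodeBits l)

lemma decodeBits_bits (n : ℕ) : decodeBits n.bits = n := by
  induction n using Nat.binaryRec' with
  | zero => simp [decodeBits]
  | bit b n h ih => rw [Nat.bits_append_bit _ _ h, decodeBits, ih]

/-- The state of a node with `δ` ports in the counting algorithm. -/
structure NodeState (δ : ℕ) where
  /-- The approximation of the network size. -/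
  approx : ℕ
  /-- Which ports lead to labeled edges. -/
  label : Fin δ → Bool
  /-- The number of rounds so far. -/
  time : ℕ
  /-- The number received over each port. -/
  received : Fin δ → Option ℕ
  /-- The ports over which a number has been sent. -/
  done : Fin δ → Bool

namespace NodeState

variable {δ : ℕ} (s : NodeState δ)

/-- A number can be sent over port `p`, since the numbers from all other labeled ports are known. -/
def Ready (p : Fin δ) : Prop :=
  s.label p = true ∧ ∀ q, q ≠ p → s.label q = true → (s.received q).isSome

/-- The number that is sent over port `p`. -/
def branchSize (p : Fin δ) : ℕ :=
  1 + ∑ q ∈ Finset.univ.filter (fun q => s.label q = true ∧ q ≠ p), (s.received q).getD 0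

/-- The number of nodes in the component, once all numbers have been received. -/
def size : ℕ :=
  1 + ∑ q ∈ Finset.univ.filter (fun q => s.label q = true), (s.received q).getD 0

/-- The condition under which a node accepts when its time is over. -/
def Accepts (α : ℝ) : Prop :=
  (∀ q, s.label q = true → (s.received q).isSome) ∧ (s.approx : ℝ) ≤ α * s.size

open Classical in
/-- A number is sent over each port as soon as possible, and only once. -/
noncomputable def send (p : Fin δ) : Option (List Bool) :=
  if s.Ready p ∧ s.done p = false then some (s.branchSize p).bits else none

open Classical in
/-- The state after one more round. -/
noncomputable def receive (inbox : Fin δ → Option (List Bool)) : NodeState δ where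
  approx := s.approx
  label := s.label
  time := s.time + 1
  received p := ((inbox p).map decodeBits).or (s.received p)
  done p := decide (s.Ready p)

open Classical in
/-- The output after `2 * approx` rounds. -/
noncomputable def output (α : ℝ) : Option Bool :=
  if s.time < 2 * s.approx then none else some (decide (s.Accepts α))

end NodeState

/-- The counting algorithm. It does not use the node IDs. -/
noncomputable def countingAlgorithm (α : ℝ) : Algorithm where
  State := NodeState
  init _ approx label := ⟨approx, label, 0, fun _ => none, fun _ => false⟩
  send := NodeState.send
  receive := NodeState.receive
  output s := s.output α

namespace Input

variable {V : Type} (I : Input V)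

lemma neighbor_injective (v : V) : Function.Injective (I.neighbor v) := fun _ _ h =>
  (I.port v).injective (Subtype.ext h)

lemma neighbor_backPort (v : V) (p : Fin (I.deg v)) :
    I.neighbor (I.neighbor v p) (I.backPort v p) = v := by
  change ((I.port _) ((I.port _).symm _)).1 = v
  rw [Equiv.apply_symm_apply]

lemma exists_neighbor_eq {v w : V} (h : I.graph.Adj v w) : ∃ p, I.neighbor v p = w :=
  ⟨(I.port v).symm ⟨w, h⟩, by simp [neighbor]⟩

lemma adj_neighbor (v : V) (p : Fin (I.deg v)) : I.graph.Adj v (I.neighbor v p) := (I.port v p).2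

lemma label_eq_true {v : V} {p : Fin (I.deg v)} :
    I.label v p = true ↔ I.tree.Adj v (I.neighbor v p) := by
  simp [label]

/-- `Branch.join`, where the neighbors of `v` other than `u` are given by a set of ports. -/
lemma branch_join [Finite V] {v u : V} (s : Finset (Fin (I.deg v))) (f : Fin (I.deg v) → ℕ)
    (hs : ∀ p, p ∈ s ↔ I.tree.Adj v (I.neighbor v p) ∧ I.neighbor v p ≠ u)
    (hbr : ∀ p ∈ s, Branch I.tree (I.neighbor v p) v (f p)) :
    Branch I.tree v u (1 + ∑ p ∈ s, f p) := by
  refine Branch.join s (I.neighbor v) f (I.neighbor_injective v).injOn (fun p hp => ((hs p).1 hp).1)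
    (fun p hp => ((hs p).1 hp).2) (fun w hw => ?_) hbr
  obtain ⟨p, rfl⟩ := I.exists_neighbor_eq (I.tree_le hw)
  by_cases h : I.neighbor v p = u
  · exact Or.inl h
  · exact Or.inr ⟨p, (hs p).2 ⟨hw, h⟩, rfl⟩

end Input

/-! ### Executions -/

section Execution

variable (α : ℝ) {V : Type} (I : Input V)

/-- The state of node `v` after `r` rounds of the counting algorithm. -/
noncomputable def nodeState (r : ℕ) (v : V) : NodeState (I.deg v) :=
  (countingAlgorithm α).state I r v

lemma nodeState_zero (v : V) : nodeState α I 0 v =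
    ⟨I.approx, I.label v, 0, fun _ => none, fun _ => false⟩ := rfl

lemma nodeState_succ (r : ℕ) (v : V) : nodeState α I (r + 1) v =
    if ((nodeState α I r v).output α).isSome then nodeState α I r v
    else (nodeState α I r v).receive
      (fun p => (countingAlgorithm α).sent I r (I.neighbor v p) (I.backPort v p)) := rfl

lemma nodeState_basic (r : ℕ) (v : V) : (nodeState α I r v).approx = I.approx ∧
    (nodeState α I r v).label = I.label v ∧ (nodeState α I r v).time = min r (2 * I.approx) := by
  induction r with
  | zero => exact ⟨rfl, rfl, (Nat.zero_min _).symm⟩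
  | succ r ih =>
    obtain ⟨h1, h2, h3⟩ := ih
    rw [nodeState_succ, NodeState.output, h1, h3]
    by_cases h : min r (2 * I.approx) < 2 * I.approx
    · simp only [h, if_true, Option.isSome_none, Bool.false_eq_true, if_false]
      exact ⟨h1, h2, by simp only [NodeState.receive, h3]; omega⟩
    · simp only [h, if_false, Option.isSome_some, if_true]
      exact ⟨h1, h2, by omega⟩

lemma approx_nodeState (r : ℕ) (v : V) : (nodeState α I r v).approx = I.approx :=
  (nodeState_basic α I r v).1

lemma label_nodeState {r : ℕ} {v : V} {p : Fin (I.deg v)} :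
    (nodeState α I r v).label p = true ↔ I.tree.Adj v (I.neighbor v p) := by
  rw [(nodeState_basic α I r v).2.1, I.label_eq_true]

open Classical in
lemma output_nodeState (r : ℕ) (v : V) : (nodeState α I r v).output α =
    if r < 2 * I.approx then none else some (decide ((nodeState α I r v).Accepts α)) := by
  have h : (nodeState α I r v).time < 2 * (nodeState α I r v).approx ↔ r < 2 * I.approx := by
    rw [approx_nodeState, (nodeState_basic α I r v).2.2]
    omega
  simp only [NodeState.output, h]

lemma outputs_iff {v : V} {b : Bool} : (countingAlgorithm α).Outputs I v b ↔
    ∃ r, (nodeState α I r v).output α = some b := Iff.rfl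

lemma sent_eq (r : ℕ) (v : V) (p : Fin (I.deg v)) : (countingAlgorithm α).sent I r v p =
    if ((nodeState α I r v).output α).isSome then none else (nodeState α I r v).send p := rfl

lemma sent_eq_some_iff {r : ℕ} {v : V} {p : Fin (I.deg v)} {m : List Bool} :
    (countingAlgorithm α).sent I r v p = some m ↔ r < 2 * I.approx ∧
      (nodeState α I r v).Ready p ∧ (nodeState α I r v).done p = false ∧
        ((nodeState α I r v).branchSize p).bits = m := by
  rw [sent_eq, output_nodeState]
  by_cases h : r < 2 * I.approx <;> simp [h, NodeState.send, and_assoc]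

lemma nodeState_succ_of_lt (r : ℕ) (hr : r < 2 * I.approx) (v : V) :
    nodeState α I (r + 1) v = (nodeState α I r v).receive
      (fun p => (countingAlgorithm α).sent I r (I.neighbor v p) (I.backPort v p)) := by
  rw [nodeState_succ, output_nodeState]
  simp [hr]

lemma nodeState_succ_of_le (r : ℕ) (hr : 2 * I.approx ≤ r) (v : V) :
    nodeState α I (r + 1) v = nodeState α I r v := by
  rw [nodeState_succ, output_nodeState]
  simp [hr.not_gt]

lemma received_succ (r : ℕ) (hr : r < 2 * I.approx) (v : V) (p : Fin (I.deg v)) :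
    (nodeState α I (r + 1) v).received p =
      (((countingAlgorithm α).sent I r (I.neighbor v p) (I.backPort v p)).map decodeBits).or
        ((nodeState α I r v).received p) := by
  rw [nodeState_succ_of_lt α I r hr, NodeState.receive]

lemma done_succ (r : ℕ) (hr : r < 2 * I.approx) (v : V) (p : Fin (I.deg v)) :
    (nodeState α I (r + 1) v).done p = true ↔ (nodeState α I r v).Ready p := by
  rw [nodeState_succ_of_lt α I r hr]
  simp [NodeState.receive]

lemma received_mono {r r' : ℕ} (h : r ≤ r') {v : V} {p : Fin (I.deg v)}
    (hp : ((nodeState α I r v).received p).isSome) :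
    ((nodeState α I r' v).received p).isSome := by
  induction r', h using Nat.le_induction with
  | base => exact hp
  | succ r' _ ih =>
    obtain hr | hr := lt_or_ge r' (2 * I.approx)
    · rw [received_succ α I r' hr]
      simp [ih]
    · rwa [nodeState_succ_of_le α I r' hr]

lemma ready_mono {r r' : ℕ} (h : r ≤ r') {v : V} {p : Fin (I.deg v)}
    (hp : (nodeState α I r v).Ready p) : (nodeState α I r' v).Ready p := by
  refine ⟨(label_nodeState α I).2 ((label_nodeState α I).1 hp.1), fun q hq hl => ?_⟩
  exact received_mono α I h (hp.2 q hq ((label_nodeState α I).2 ((label_nodeState α I).1 hl)))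

lemma ready_of_done {r : ℕ} {v : V} {p : Fin (I.deg v)} (h : (nodeState α I r v).done p = true) :
    (nodeState α I r v).Ready p := by
  induction r with
  | zero => exact absurd h (by simp [nodeState_zero])
  | succ r ih =>
    obtain hr | hr := lt_or_ge r (2 * I.approx)
    · exact ready_mono α I r.le_succ ((done_succ α I r hr v p).1 h)
    · rw [nodeState_succ_of_le α I r hr] at h ⊢
      exact ih h

lemma done_of_sent {r r' : ℕ} (h : r < r') {v : V} {p : Fin (I.deg v)}
    (hs : ((countingAlgorithm α).sent I r v p).isSome) : (nodeState α I r' v).done p = true := by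
  obtain ⟨m, hm⟩ := Option.isSome_iff_exists.1 hs
  obtain ⟨hr, hready, -⟩ := (sent_eq_some_iff α I).1 hm
  induction r', h using Nat.le_induction with
  | base => exact (done_succ α I r hr v p).2 hready
  | succ r' _ ih =>
    obtain hr' | hr' := lt_or_ge r' (2 * I.approx)
    · exact (done_succ α I r' hr' v p).2 (ready_of_done α I ih)
    · rwa [nodeState_succ_of_le α I r' hr']

/-! ### Soundness -/

lemma branch_branchSize [Finite V] {r : ℕ} {v : V} {p : Fin (I.deg v)}
    (hrec : ∀ q x, (nodeState α I r v).received q = some x → Branch I.tree (I.neighbor v q) v x)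
    (hp : (nodeState α I r v).Ready p) :
    Branch I.tree v (I.neighbor v p) ((nodeState α I r v).branchSize p) := by
  refine I.branch_join _ _ (fun q => ?_) fun q hq => ?_
  · rw [Finset.mem_filter, label_nodeState, (I.neighbor_injective v).ne_iff]
    simp
  · rw [Finset.mem_filter] at hq
    obtain ⟨x, hx⟩ := Option.isSome_iff_exists.1 (hp.2 q hq.2.2 hq.2.1)
    rw [hx]
    exact hrec q x hx

lemma branch_of_received [Finite V] {r : ℕ} {v : V} {p : Fin (I.deg v)} {x : ℕ}
    (h : (nodeState α I r v).received p = some x) : Branch I.tree (I.neighbor v p) v x := by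
  induction r generalizing v p x with
  | zero => exact absurd h (by simp [nodeState_zero])
  | succ r ih =>
    obtain hr | hr := lt_or_ge r (2 * I.approx)
    · rw [received_succ α I r hr, Option.or_eq_some_iff, Option.map_eq_some_iff] at h
      obtain ⟨m, hm, rfl⟩ | ⟨-, h⟩ := h
      · obtain ⟨-, hready, -, rfl⟩ := (sent_eq_some_iff α I).1 hm
        have := branch_branchSize α I (fun q y hy => ih hy) hready
        rwa [I.neighbor_backPort, ← decodeBits_bits (NodeState.branchSize _ _)] at this
      · exact ih h
    · rw [nodeState_succ_of_le α I r hr] at h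
      exact ih h

lemma branch_of_sent [Finite V] {r : ℕ} {v : V} {p : Fin (I.deg v)} {m : List Bool}
    (h : (countingAlgorithm α).sent I r v p = some m) :
    I.tree.Adj v (I.neighbor v p) ∧ ∃ x, Branch I.tree v (I.neighbor v p) x ∧ m = x.bits := by
  obtain ⟨-, hready, -, rfl⟩ := (sent_eq_some_iff α I).1 h
  exact ⟨(label_nodeState α I).1 hready.1, _,
    branch_branchSize α I (fun q y hy => branch_of_received α I hy) hready, rfl⟩

lemma branch_size [Finite V] {r : ℕ} {v : V}
    (h : ∀ q, (nodeState α I r v).label q = true → ((nodeState α I r v).received q).isSome) :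
    Branch I.tree v v (nodeState α I r v).size := by
  refine I.branch_join _ _ (fun q => ?_) fun q hq => ?_
  · rw [Finset.mem_filter, label_nodeState]
    simp [(I.adj_neighbor v q).ne']
  · rw [Finset.mem_filter] at hq
    obtain ⟨x, hx⟩ := Option.isSome_iff_exists.1 (h q hq.2)
    rw [hx]
    exact branch_of_received α I hx

lemma terminatesWithin : (countingAlgorithm α).TerminatesWithin I (2 * I.approx) := by
  intro v
  change ((nodeState α I _ v).output α).isSome = true
  rw [output_nodeState]
  simp

lemma outputs_true_or_false (v : V) :
    (countingAlgorithm α).Outputs I v true ∨ (countingAlgorithm α).Outputs I v false := by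
  obtain ⟨b, hb⟩ := Option.isSome_iff_exists.1 (terminatesWithin α I v)
  cases b
  · exact Or.inr ⟨_, hb⟩
  · exact Or.inl ⟨_, hb⟩

lemma exists_branch_of_outputs_true [Finite V] {v : V}
    (h : (countingAlgorithm α).Outputs I v true) :
    ∃ x, Branch I.tree v v x ∧ (I.approx : ℝ) ≤ α * x := by
  obtain ⟨r, hr⟩ := (outputs_iff α I).1 h
  rw [output_nodeState] at hr
  split_ifs at hr
  have hacc : (nodeState α I r v).Accepts α := by simpa using hr
  refine ⟨_, branch_size α I hacc.1, ?_⟩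
  simpa only [approx_nodeState] using hacc.2

/-! ### Completeness -/

/-- If the node at the other end of `p` has already sent a number, it has arrived. -/
lemma received_of_done {r : ℕ} {v : V} {p : Fin (I.deg v)}
    (h : (nodeState α I r (I.neighbor v p)).done (I.backPort v p) = true) :
    ((nodeState α I r v).received p).isSome := by
  induction r with
  | zero => exact absurd h (by simp [nodeState_zero])
  | succ r ih =>
    obtain hr | hr := lt_or_ge r (2 * I.approx)
    · have hready := (done_succ α I r hr _ _).1 h
      rw [received_succ α I r hr]
      cases hd : (nodeState α I r (I.neighbor v p)).done (I.backPort v p)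
      · rw [(sent_eq_some_iff α I).2 ⟨hr, hready, hd, rfl⟩]
        simp
      · simp [ih hd]
    · rw [nodeState_succ_of_le α I r hr] at h ⊢
      exact ih h

/-- In a tree, a message arrives within as many rounds as the sender's side of the edge has nodes,
since the sides that it waits for are strictly smaller. -/
lemma received_of_isTree [Finite V] (hT : I.tree.IsTree) (k : ℕ) {r : ℕ} {v : V}
    {p : Fin (I.deg v)} (hadj : I.tree.Adj v (I.neighbor v p))
    (hk : (side I.tree (I.neighbor v p) v).ncard ≤ k) (hkr : k ≤ r) (hr : k ≤ 2 * I.approx) :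
    ((nodeState α I r v).received p).isSome := by
  have hbridge := isAcyclic_iff_forall_adj_isBridge.1 hT.isAcyclic
  refine received_mono α I hkr ?_
  clear hkr
  induction k generalizing v p with
  | zero =>
    rw [Nat.le_zero, Set.ncard_eq_zero] at hk
    exact absurd mem_side_self (hk ▸ Set.notMem_empty _)
  | succ k ih =>
    refine received_of_done α I ((done_succ α I k hr _ _).2 ⟨?_, fun q hq hl => ?_⟩)
    · rw [label_nodeState, I.neighbor_backPort]
      exact hadj.symm
    · rw [label_nodeState] at hl
      refine ih hl (Nat.lt_succ_iff.1 (lt_of_lt_of_le ?_ hk)) (by omega)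
      have hnot : I.neighbor v p ∉ side I.tree (I.neighbor (I.neighbor v p) q) (I.neighbor v p) :=
        hbridge hl.symm
      refine Set.ncard_lt_ncard ((side_subset_side hl ?_ hnot).ssubset_of_mem_notMem
        mem_side_self hnot)
      intro h
      exact hq (I.neighbor_injective _ (h.trans (I.neighbor_backPort v p).symm))

lemma outputs_true_of_isTree [Fintype V] (hT : I.tree.IsTree)
    (hn : Fintype.card V ≤ 2 * I.approx) (hα : (I.approx : ℝ) ≤ α * Fintype.card V) (v : V) :
    (countingAlgorithm α).Outputs I v true := by
  have hrec : ∀ q, (nodeState α I (2 * I.approx) v).label q = true →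
      ((nodeState α I (2 * I.approx) v).received q).isSome := by
    intro q hq
    rw [label_nodeState] at hq
    refine received_of_isTree α I hT (Fintype.card V) hq ?_ hn hn
    rw [← Nat.card_eq_fintype_card]
    exact Set.ncard_le_card _
  refine (outputs_iff α I).2 ⟨2 * I.approx, ?_⟩
  rw [output_nodeState]
  have hsize : (nodeState α I (2 * I.approx) v).size = Fintype.card V := by
    rw [← (branch_size α I hrec).ncard_eq, ← Nat.card_eq_fintype_card, ← Set.ncard_univ]
    congr 1
    exact Set.eq_univ_of_forall fun w => mem_side_diag.2 (hT.preconnected v w)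
  have hacc : (nodeState α I (2 * I.approx) v).Accepts α :=
    ⟨hrec, by rw [hsize, approx_nodeState]; exact hα⟩
  simp [hacc]

/-! ### Complexity -/

/-- Every message is charged to a pair of a node and an incident bridge, at most one to each. -/
lemma messages_le [Fintype V] [Nonempty V] (R : ℕ) :
    (countingAlgorithm α).messages I R ≤ 2 * (Fintype.card V - 1) := by
  classical
  refine le_trans ?_ (card_filter_adj_isBridge_le I.tree)
  rw [Algorithm.messages, Finset.sum_comm]
  refine Finset.sum_le_sum fun v _ => ?_
  -- the ports used in different rounds are different
  rw [← Finset.card_biUnion, ← Set.ncard_coe_finset]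
  · refine Set.ncard_le_ncard_of_injOn (I.neighbor v) ?_ (I.neighbor_injective v).injOn
    intro p hp
    simp only [Finset.coe_biUnion, Set.mem_iUnion, Finset.mem_coe, Finset.mem_filter] at hp
    obtain ⟨r, -, -, hp⟩ := hp
    obtain ⟨m, hm⟩ := Option.isSome_iff_exists.1 hp
    obtain ⟨hadj, x, hx, -⟩ := branch_of_sent α I hm
    exact ⟨hadj, hx.isBridge v mem_side_self _ hadj⟩
  · have key : ∀ r r' p, r < r' → ((countingAlgorithm α).sent I r v p).isSome →
        ((countingAlgorithm α).sent I r' v p).isSome → False := by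
      intro r r' p h hs hs'
      obtain ⟨m, hm⟩ := Option.isSome_iff_exists.1 hs'
      have := ((sent_eq_some_iff α I).1 hm).2.2.1
      rw [done_of_sent α I h hs] at this
      cases this
    intro r _ r' _ hrr
    rw [Function.onFun, Finset.disjoint_left]
    intro p hp hp'
    rw [Finset.mem_filter] at hp hp'
    obtain h | h := Nat.lt_or_gt_of_ne hrr
    · exact key r r' p h hp.2 hp'.2
    · exact key r' r p h hp'.2 hp.2

lemma half_le_log {n : ℕ} (hn : 2 ≤ n) : (1 / 2 : ℝ) ≤ Real.log n := by
  have h1 : Real.log 2 ≤ Real.log n := Real.log_le_log (by norm_num) (by exact_mod_cast hn)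
  linarith [Real.log_two_gt_d9]

lemma length_bits_le {x n : ℕ} (hn : 2 ≤ n) (hx : x ≤ n) :
    (x.bits.length : ℝ) ≤ 4 * Real.log n := by
  have h2 := Real.log_two_gt_d9
  have hlog := half_le_log hn
  rw [Nat.size_eq_bits_len]
  obtain h0 | h0 := Nat.eq_zero_or_pos x.size
  · rw [h0]
    push_cast
    linarith
  have hpow : 2 ^ (x.size - 1) ≤ n := le_trans (Nat.lt_size.1 (by omega)) hx
  have hl : Real.log ((2 : ℝ) ^ (x.size - 1)) ≤ Real.log n :=
    Real.log_le_log (by positivity) (by exact_mod_cast hpow)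
  rw [Real.log_pow, Nat.cast_sub h0, Nat.cast_one] at hl
  nlinarith

lemma messageBitsLE [Fintype V] :
    (countingAlgorithm α).MessageBitsLE I (4 * Real.log (Fintype.card V)) := by
  intro r v p m hm
  obtain ⟨-, x, hx, rfl⟩ := branch_of_sent α I hm
  refine length_bits_le ?_ hx.le_card
  have : Nontrivial V := ⟨v, I.neighbor v p, (I.adj_neighbor v p).ne⟩
  exact Fintype.one_lt_card

end Execution

end CongestKT0

open CongestKT0 in
theorem theorem4 :
    ∃ (C : ℝ) (B : ℕ → ℝ), ∀ α : ℝ, 1 ≤ α → α < Real.sqrt 2 →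
      ∃ A : Algorithm, ∀ (c : ℕ) (V : Type) [Fintype V] (I : Input V),
        IsApprox α (Fintype.card V) I.approx →
        (∀ v, I.id v ≤ Fintype.card V ^ c) →
          -- every message fits the bandwidth
          A.MessageBitsLE I (B c * Real.log (Fintype.card V)) ∧
          -- every node terminates
          (∃ R : ℕ, A.TerminatesWithin I R) ∧
          -- time complexity
          (2 ≤ Fintype.card V →
            ∃ R : ℕ, (R : ℝ) ≤ C * (Fintype.card V * Real.log (Fintype.card V)) ∧
              A.TerminatesWithin I R) ∧
          -- message complexity
          (∀ R : ℕ, (A.messages I R : ℝ) ≤ C * (Fintype.card V * Real.log (Fintype.card V))) ∧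
          -- correctness
          A.AcceptsIfLegal I ∧
          A.OneDetects I ∧
          (α = 1 → A.AllDetect I) := by
  refine ⟨8, fun _ => 4, fun α h1 h2 => ⟨countingAlgorithm α, fun c V _ I hI _ => ?_⟩⟩
  have : Nonempty V := I.connected.nonempty
  set n := Fintype.card V with hn
  have hn1 : 1 ≤ n := Fintype.card_pos
  have hn1' : (1 : ℝ) ≤ n := by exact_mod_cast hn1
  have hsq : α * α < 2 := by
    have := Real.mul_self_sqrt (show (0 : ℝ) ≤ 2 by norm_num)
    nlinarith
  have hα2 : α < 2 := by nlinarith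
  have hlow : (n : ℝ) ≤ α * I.approx := (div_le_iff₀' (by linarith)).1 hI.1
  have happ : (0 : ℝ) ≤ I.approx := Nat.cast_nonneg _
  have hlog : 2 ≤ n → (n : ℝ) ≤ 2 * (n * Real.log n) := fun h => by
    nlinarith [half_le_log h]
  refine ⟨messageBitsLE α I, ⟨_, terminatesWithin α I⟩, fun h2n => ⟨_, ?_, terminatesWithin α I⟩,
    fun R => ?_, fun hT => outputs_true_of_isTree α I hT ?_ hI.2, fun hT => ?_, ?_⟩
  · have := hlog h2n
    have := hI.2
    push_cast
    nlinarith
  · have hm := messages_le α I R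
    rw [← hn] at hm
    obtain h | h := hn1.eq_or_lt
    · rw [← h] at hm ⊢
      have : (countingAlgorithm α).messages I R = 0 := by omega
      simp [this]
    · have hm' : ((countingAlgorithm α).messages I R : ℝ) ≤ 2 * n := by
        exact_mod_cast (by omega : (countingAlgorithm α).messages I R ≤ 2 * n)
      linarith [hlog h]
  · have : (n : ℝ) ≤ 2 * I.approx := by nlinarith
    exact_mod_cast this
  · by_contra! hcon
    refine hT (isTree_of_forall_branch fun v => ?_)
    obtain ⟨x, hx, hle⟩ := exists_branch_of_outputs_true α I
      ((outputs_true_or_false α I v).resolve_right (hcon v))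
    refine ⟨x, hx, ?_⟩
    -- `n ≤ α * approx ≤ α ^ 2 * x < 2 * x`
    have hx0 : (0 : ℝ) < x := by
      by_contra! h0
      nlinarith
    have : (n : ℝ) < 2 * x := by nlinarith
    exact_mod_cast this
  · rintro rfl hT v
    refine (outputs_true_or_false 1 I v).resolve_left fun hv => hT ?_
    obtain ⟨x, hx, hle⟩ := exists_branch_of_outputs_true 1 I hv
    refine hx.isTree_of_card_le ?_
    have : (n : ℝ) ≤ x := by linarith
    exact_mod_cast this
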